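/- Let $\mathbb{k}$ be a field and let $n\ge 0$. For each pair $1\le i<j\le n$ fix exactly one of the following two quadratic relations: either (a) $x_ix_j=c_{ij}x_jx_i$ with a given $c_{ij}\in\mathbb{k}^\times$, or (b) $x_jx_i=0$. Assume that the relations of type (b) are transitive: if $i<j<k$ and both $x_kx_j=0$ and $x_jx_i=0$ are among the chosen relations, then so is $x_kx_i=0$. Let $A$ be the associative unital $\mathbb{k}$-algebra with generators $x_1,\dots,x_n$ subject to the relations $x_i^2=0$ for all $i$ and the chosen relation for each pair $i<j$, graded by $\deg x_i=1$. Then $A$ is Koszul: $A_0=\mathbb{k}$ and $\operatorname{Ext}_A^{i}(\mathbb{k},\mathbb{k})_j=0$ for all $i\neq j$, where $\mathbb{k}=A/A_{>0}$ is the trivial module, $i$ is the homological degree and $j$ is the internal degree induced by the grading of $A$. -/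

import Mathlib

open scoped DirectSum

namespace BarExt

section

variable {𝕜 A : Type*} [Field 𝕜] [Ring A] [Algebra 𝕜 A]
variable (𝒜 : ℕ → Submodule 𝕜 A) [GradedAlgebra 𝒜]

/-- The augmentation ideal `A₊ = ⨁_{d > 0} A_d` of an `ℕ`-graded algebra `A`, as a `𝕜`-subspace. -/
def augIdeal : Submodule 𝕜 A :=
  (HomogeneousIdeal.irrelevant 𝒜).toIdeal.restrictScalars 𝕜

/-- The multiplication `A₊ × A₊ → A₊`. -/
def augMul : augIdeal 𝒜 →ₗ[𝕜] augIdeal 𝒜 →ₗ[𝕜] augIdeal 𝒜 :=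
  LinearMap.mk₂ 𝕜
    (fun a b => ⟨(a : A) * (b : A),
      Ideal.mul_mem_left (HomogeneousIdeal.irrelevant 𝒜).toIdeal (a : A) b.2⟩)
    (fun a b c => Subtype.ext (add_mul (a : A) b c))
    (fun r a b => Subtype.ext (smul_mul_assoc r (a : A) (b : A)))
    (fun a b c => Subtype.ext (mul_add (a : A) b c))
    (fun r a b => Subtype.ext (mul_smul_comm r (a : A) (b : A)))

theorem augMul_assoc (a b c : augIdeal 𝒜) :
    augMul 𝒜 (augMul 𝒜 a b) c = augMul 𝒜 a (augMul 𝒜 b c) :=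
  Subtype.ext (mul_assoc (a : A) b c)

/-- The cochains of homological degree `i` of the reduced bar construction: the `𝕜`-multilinear
forms on `A₊ ^ i`. As `Hom_A(A ⊗ A₊^{⊗ i}, 𝕜) = Hom_𝕜(A₊^{⊗ i}, 𝕜)`, they are what one gets by
applying `Hom_A(-, 𝕜)` to the reduced bar resolution
`⋯ → A ⊗ A₊ ⊗ A₊ → A ⊗ A₊ → A → 𝕜` of the trivial module `𝕜 = A / A₊`. -/
abbrev Cochain (i : ℕ) : Type _ :=
  MultilinearMap 𝕜 (fun _ : Fin i => augIdeal 𝒜) 𝕜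

/-- `(a_0, …, a_i) ↦ (a_0, …, a_p a_{p+1}, …, a_i)`. -/
def merge {i : ℕ} (p : Fin i) (a : Fin (i + 1) → augIdeal 𝒜) : Fin i → augIdeal 𝒜 :=
  p.castSucc.contractNth (fun u v => augMul 𝒜 u v) a

theorem merge_of_lt {i : ℕ} (p : Fin i) (a : Fin (i + 1) → augIdeal 𝒜) (k : Fin i) (h : k < p) :
    merge 𝒜 p a k = a k.castSucc :=
  Fin.contractNth_apply_of_lt _ _ _ _ h

theorem merge_self {i : ℕ} (p : Fin i) (a : Fin (i + 1) → augIdeal 𝒜) :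
    merge 𝒜 p a p = augMul 𝒜 (a p.castSucc) (a p.succ) :=
  Fin.contractNth_apply_of_eq _ _ _ _ rfl

theorem merge_of_gt {i : ℕ} (p : Fin i) (a : Fin (i + 1) → augIdeal 𝒜) (k : Fin i) (h : p < k) :
    merge 𝒜 p a k = a k.succ :=
  Fin.contractNth_apply_of_gt _ _ _ _ h

theorem merge_update {i : ℕ} (p : Fin i) (a : Fin (i + 1) → augIdeal 𝒜) (r : Fin (i + 1)) :
    ∃ (q : Fin i) (L : augIdeal 𝒜 →ₗ[𝕜] augIdeal 𝒜), ∀ x,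
      merge 𝒜 p (Function.update a r x) = Function.update (merge 𝒜 p a) q (L x) := by
  have key : ∀ (q : Fin i) (L : augIdeal 𝒜 →ₗ[𝕜] augIdeal 𝒜),
      (∀ x, merge 𝒜 p (Function.update a r x) q = L x) →
      (∀ k, k ≠ q → (k < p → k.castSucc ≠ r) ∧ (k = p → k.castSucc ≠ r ∧ k.succ ≠ r) ∧
        (p < k → k.succ ≠ r)) →
      ∃ (q : Fin i) (L : augIdeal 𝒜 →ₗ[𝕜] augIdeal 𝒜), ∀ x,
        merge 𝒜 p (Function.update a r x) = Function.update (merge 𝒜 p a) q (L x) := by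
    intro q L h1 h2
    refine ⟨q, L, fun x => funext fun k => ?_⟩
    by_cases hk : k = q
    · subst hk; simp [h1]
    · rw [Function.update_of_ne hk]
      obtain ⟨h3, h4, h5⟩ := h2 k hk
      rcases lt_trichotomy k p with h | h | h
      · rw [merge_of_lt _ _ _ _ h, merge_of_lt _ _ _ _ h, Function.update_of_ne (h3 h)]
      · subst h
        rw [merge_self, merge_self, Function.update_of_ne (h4 rfl).1,
          Function.update_of_ne (h4 rfl).2]
      · rw [merge_of_gt _ _ _ _ h, merge_of_gt _ _ _ _ h, Function.update_of_ne (h5 h)]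
  rcases lt_trichotomy r p.castSucc with h | h | h
  · obtain ⟨q, rfl⟩ : ∃ q : Fin i, r = q.castSucc := ⟨⟨r, by have := p.2; grind⟩, rfl⟩
    refine key q LinearMap.id (fun x => ?_) fun k hk => ?_
    · rw [merge_of_lt _ _ _ _ (by simpa using h)]; simp
    · grind
  · subst h
    refine key p ((augMul 𝒜).flip (a p.succ)) (fun x => ?_) fun k hk => ?_
    · rw [merge_self, Function.update_self, Function.update_of_ne (by grind)]; rfl
    · grind
  · obtain ⟨q, rfl⟩ : ∃ q : Fin i, r = q.succ :=
      ⟨⟨r - 1, by have := r.2; grind⟩, by ext; simp; grind⟩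
    by_cases hq : q = p
    · subst hq
      refine key q (augMul 𝒜 (a q.castSucc)) (fun x => ?_) fun k hk => ?_
      · rw [merge_self, Function.update_self, Function.update_of_ne (by grind)]
      · grind
    · refine key q LinearMap.id (fun x => ?_) fun k hk => ?_
      · rw [merge_of_gt _ _ _ _ (by grind)]; simp
      · grind

/-- The differential of the reduced cobar complex:
`(δ f)(a_0, …, a_i) = ∑_{p < i} (-1)^(p+1) f(a_0, …, a_p a_{p+1}, …, a_i)`. -/
def diff (i : ℕ) : Cochain 𝒜 i →ₗ[𝕜] Cochain 𝒜 (i + 1) where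
  toFun f :=
    { toFun := fun a => ∑ p : Fin i, (-1 : 𝕜) ^ ((p : ℕ) + 1) * f (merge 𝒜 p a)
      map_update_add' := by
        intro inst a r x y
        rw [Subsingleton.elim inst (instDecidableEqFin _), ← Finset.sum_add_distrib]
        refine Finset.sum_congr rfl fun p _ => ?_
        obtain ⟨q, L, h⟩ := merge_update 𝒜 p a r
        rw [h, h, h, map_add, f.map_update_add, mul_add]
      map_update_smul' := by
        intro inst a r t x
        rw [Subsingleton.elim inst (instDecidableEqFin _), smul_eq_mul, Finset.mul_sum]
        refine Finset.sum_congr rfl fun p _ => ?_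
        obtain ⟨q, L, h⟩ := merge_update 𝒜 p a r
        rw [h, h, map_smul, f.map_update_smul, smul_eq_mul, mul_left_comm] }
  map_add' f g := by
    ext a
    simp [mul_add, Finset.sum_add_distrib]
  map_smul' t f := by
    ext a
    simp [Finset.mul_sum, mul_left_comm]

theorem diff_apply (i : ℕ) (f : Cochain 𝒜 i) (a : Fin (i + 1) → augIdeal 𝒜) :
    diff 𝒜 i f a = ∑ p : Fin i, (-1 : 𝕜) ^ ((p : ℕ) + 1) * f (merge 𝒜 p a) := rfl

theorem merge_merge {i : ℕ} (p q : Fin i) (h : p ≤ q) (a : Fin (i + 1 + 1) → augIdeal 𝒜) :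
    merge 𝒜 q (merge 𝒜 p.castSucc a) = merge 𝒜 p (merge 𝒜 q.succ a) := by
  funext k
  simp only [merge, Fin.contractNth]
  rcases lt_trichotomy k p with h1 | h1 | h1 <;> rcases lt_trichotomy k q with h2 | h2 | h2 <;>
    grind [augMul_assoc]

/-- The cobar complex is a complex. -/
theorem diff_diff (i : ℕ) (f : Cochain 𝒜 i) : diff 𝒜 (i + 1) (diff 𝒜 i f) = 0 := by
  ext a
  simp only [diff_apply, Finset.mul_sum]
  rw [← Finset.sum_product', Finset.univ_product_univ]
  change _ = (0 : 𝕜)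
  refine Finset.sum_involution (fun pq _ => if h : (pq.1 : ℕ) ≤ pq.2 then
      (pq.2.succ, ⟨pq.1, by have := pq.2.2; omega⟩)
    else (pq.2.castSucc, ⟨(pq.1 : ℕ) - 1, by have := pq.1.2; omega⟩)) ?_ ?_ ?_ ?_
  · rintro ⟨p, q⟩ -
    dsimp only
    split_ifs with h
    · have e := merge_merge 𝒜 ⟨p, by have := q.2; omega⟩ q h a
      rw [show (⟨p, by have := q.2; omega⟩ : Fin i).castSucc = p from rfl] at e
      rw [e]
      simp only [Fin.val_succ]
      ring
    · have e := merge_merge 𝒜 q ⟨(p : ℕ) - 1, by have := p.2; omega⟩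
        (by rw [Fin.le_def]; simp only; omega) a
      rw [show (⟨(p : ℕ) - 1, by have := p.2; omega⟩ : Fin i).succ = p from
        Fin.ext (by simp only [Fin.val_succ]; omega)] at e
      rw [e]
      obtain ⟨m, hm⟩ : ∃ m, (p : ℕ) = m + 1 := ⟨p - 1, by omega⟩
      simp only [Fin.val_castSucc, hm, Nat.add_sub_cancel]
      ring
  · rintro ⟨p, q⟩ - - he
    dsimp only at he
    split_ifs at he with h
    · have := congrArg (fun z => (z.1 : ℕ)) he
      simp only [Fin.val_succ] at this; omega
    · have := congrArg (fun z => (z.1 : ℕ)) he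
      simp only [Fin.val_castSucc] at this; omega
  · intros; exact Finset.mem_univ _
  · rintro ⟨p, q⟩ -
    dsimp only
    split_ifs with h h' h'
    · simp only [Fin.val_succ] at h'; omega
    · refine Prod.ext (Fin.ext ?_) (Fin.ext ?_) <;> simp
    · refine Prod.ext (Fin.ext ?_) (Fin.ext ?_) <;> simp; omega
    · simp only [Fin.val_castSucc] at h'; omega

/-- The cochains of internal degree `j`: the forms which vanish on every tuple of homogeneous
elements whose total degree is not `j`, that is, the linear forms on `(A₊^{⊗ i})_j`. -/
def cochainDeg (i j : ℕ) : Submodule 𝕜 (Cochain 𝒜 i) where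
  carrier := {f | ∀ (e : Fin i → ℕ) (a : Fin i → augIdeal 𝒜),
    (∀ p, (a p : A) ∈ 𝒜 (e p)) → ∑ p, e p ≠ j → f a = 0}
  add_mem' hf hg e a ha he := by simp [hf e a ha he, hg e a ha he]
  zero_mem' e a ha he := rfl
  smul_mem' t f hf e a ha he := by simp [hf e a ha he]

/-- Cocycles of homological degree `i` and internal degree `j`. -/
def cocycles (i j : ℕ) : Submodule 𝕜 (Cochain 𝒜 i) :=
  LinearMap.ker (diff 𝒜 i) ⊓ cochainDeg 𝒜 i j

/-- Coboundaries of homological degree `i` and internal degree `j`. -/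
def coboundaries : (i j : ℕ) → Submodule 𝕜 (Cochain 𝒜 i)
  | 0, _ => ⊥
  | i + 1, j => (cochainDeg 𝒜 i j).map (diff 𝒜 i)

theorem sum_contractNth {i : ℕ} (p : Fin i) (e : Fin (i + 1) → ℕ) :
    ∑ k, p.castSucc.contractNth (· + ·) e k = ∑ k, e k := by
  have h : ∀ k : Fin i, p.castSucc.contractNth (· + ·) e k =
      e (p.succ.succAbove k) + if k = p then e p.succ else 0 := by
    intro k
    rcases lt_trichotomy k p with h | h | h
    · rw [Fin.contractNth_apply_of_lt _ _ _ _ h, if_neg h.ne, add_zero,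
        Fin.succAbove_of_castSucc_lt _ _ (by grind)]
    · subst h
      rw [Fin.contractNth_apply_of_eq _ _ _ _ rfl, if_pos rfl,
        Fin.succAbove_of_castSucc_lt _ _ (by grind)]
    · rw [Fin.contractNth_apply_of_gt _ _ _ _ h, if_neg h.ne', add_zero,
        Fin.succAbove_of_le_castSucc _ _ (by grind)]
  rw [Fin.sum_univ_succAbove e p.succ, Finset.sum_congr rfl fun k _ => h k,
    Finset.sum_add_distrib, Finset.sum_ite_eq' Finset.univ p, if_pos (Finset.mem_univ _), add_comm]

theorem diff_mem_cochainDeg (i j : ℕ) {f : Cochain 𝒜 i} (hf : f ∈ cochainDeg 𝒜 i j) :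
    diff 𝒜 i f ∈ cochainDeg 𝒜 (i + 1) j := by
  intro e a ha he
  rw [diff_apply]
  refine Finset.sum_eq_zero fun p _ => ?_
  rw [hf (p.castSucc.contractNth (· + ·) e) (merge 𝒜 p a) (fun k => ?_)
    (by rwa [sum_contractNth]), mul_zero]
  rcases lt_trichotomy k p with h | h | h
  · rw [merge_of_lt _ _ _ _ h, Fin.contractNth_apply_of_lt _ _ _ _ h]
    exact ha _
  · subst h
    rw [merge_self, Fin.contractNth_apply_of_eq _ _ _ _ rfl]
    exact SetLike.mul_mem_graded (ha _) (ha _)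
  · rw [merge_of_gt _ _ _ _ h, Fin.contractNth_apply_of_gt _ _ _ _ h]
    exact ha _

theorem coboundaries_le_cocycles (i j : ℕ) : coboundaries 𝒜 i j ≤ cocycles 𝒜 i j := by
  cases i with
  | zero => exact bot_le
  | succ i =>
    rintro _ ⟨f, hf, rfl⟩
    exact ⟨diff_diff 𝒜 i f, diff_mem_cochainDeg 𝒜 i j hf⟩

/-- The bigraded extension group `Ext_A^i(𝕜, 𝕜)_j` of the trivial module of a connected graded
algebra `A`, with homological degree `i` and internal degree `j`: the image of the cocycles in
cochains modulo coboundaries, that is, cocycles modulo coboundaries. -/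
def ExtGroup (i j : ℕ) : Submodule 𝕜 (Cochain 𝒜 i ⧸ coboundaries 𝒜 i j) :=
  (cocycles 𝒜 i j).map (coboundaries 𝒜 i j).mkQ

/-- A graded algebra `A` is Koszul if `A_0 = 𝕜` and `Ext_A^i(𝕜, 𝕜)_j = 0` for all `i ≠ j`. -/
def IsKoszul : Prop :=
  Function.Bijective (algebraMap 𝕜 (𝒜 0)) ∧
    ∀ i j : ℕ, i ≠ j → ExtGroup 𝒜 i j = ⊥

end

end BarExt

/-- The defining relations, on the free algebra with generators `x_i`, `i : Fin n`:
`x_i ^ 2 = 0`, and for each pair `i < j` exactly one relation, namely `x_j x_i = 0` if `Z j i`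
holds and `x_i x_j = c_{ij} x_j x_i` otherwise. -/
inductive SkewRel {𝕜 : Type*} [Field 𝕜] {n : ℕ} (c : Fin n → Fin n → 𝕜ˣ)
    (Z : Fin n → Fin n → Prop) : FreeAlgebra 𝕜 (Fin n) → FreeAlgebra 𝕜 (Fin n) → Prop
  | sq (i : Fin n) : SkewRel c Z (FreeAlgebra.ι 𝕜 i * FreeAlgebra.ι 𝕜 i) 0
  | comm (i j : Fin n) (hij : i < j) (h : ¬ Z j i) :
      SkewRel c Z (FreeAlgebra.ι 𝕜 i * FreeAlgebra.ι 𝕜 j)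
        ((c i j : 𝕜) • (FreeAlgebra.ι 𝕜 j * FreeAlgebra.ι 𝕜 i))
  | zero (i j : Fin n) (hij : i < j) (h : Z j i) :
      SkewRel c Z (FreeAlgebra.ι 𝕜 j * FreeAlgebra.ι 𝕜 i) 0

namespace SkewAlg
section
variable {𝕜 : Type*} [Field 𝕜] {n : ℕ} (c : Fin n → Fin n → 𝕜ˣ) (Z : Fin n → Fin n → Prop)

/-- The `𝕜`-algebra with generators `x_i` and the above relations. -/
abbrev Alg : Type _ := RingQuot (SkewRel c Z)

/-- The generator `x_i`. -/
def x (i : Fin n) : Alg c Z := RingQuot.mkAlgHom 𝕜 (SkewRel c Z) (FreeAlgebra.ι 𝕜 i)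

/-- The span of the generators. -/
def gens : Submodule 𝕜 (Alg c Z) := Submodule.span 𝕜 (Set.range (x c Z))

/-- The grading by word length: degree `d` is spanned by the products of `d` generators. -/
abbrev grading (d : ℕ) : Submodule 𝕜 (Alg c Z) := gens c Z ^ d

theorem x_mem (i : Fin n) : x c Z i ∈ grading c Z 1 := by
  simpa [grading, gens] using Submodule.subset_span (Set.mem_range_self i)

/-- `x_i` placed in degree `1` of the external direct sum. -/
def xDeg (i : Fin n) : ⨁ d, grading c Z d :=
  DirectSum.of (fun d => grading c Z d) 1 ⟨x c Z i, x_mem c Z i⟩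

theorem x_sq (i : Fin n) : x c Z i * x c Z i = 0 := by
  simpa [x] using RingQuot.mkAlgHom_rel 𝕜 (SkewRel.sq (c := c) (Z := Z) i)

theorem x_comm (i j : Fin n) (hij : i < j) (h : ¬ Z j i) :
    x c Z i * x c Z j = (c i j : 𝕜) • (x c Z j * x c Z i) := by
  simpa [x] using RingQuot.mkAlgHom_rel 𝕜 (SkewRel.comm (c := c) (Z := Z) i j hij h)

theorem x_zero (i j : Fin n) (hij : i < j) (h : Z j i) : x c Z j * x c Z i = 0 := by
  simpa [x] using RingQuot.mkAlgHom_rel 𝕜 (SkewRel.zero (c := c) (Z := Z) i j hij h)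

theorem xDeg_mul (i j : Fin n) : xDeg c Z i * xDeg c Z j =
    DirectSum.of (fun d => grading c Z d) (1 + 1)
      ⟨x c Z i * x c Z j, SetLike.mul_mem_graded (x_mem c Z i) (x_mem c Z j)⟩ := by
  rw [xDeg, xDeg, DirectSum.of_mul_of]; rfl

/-- The decomposition of an element into homogeneous components. -/
def toDirectSum : Alg c Z →ₐ[𝕜] ⨁ d, grading c Z d :=
  RingQuot.liftAlgHom 𝕜 ⟨FreeAlgebra.lift 𝕜 (xDeg c Z), by
    intro a b hab
    cases hab with
    | sq i =>
      simp only [map_mul, FreeAlgebra.lift_ι_apply, map_zero, xDeg_mul, x_sq]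
      exact map_zero _
    | comm i j hij h =>
      simp only [map_mul, map_smul, FreeAlgebra.lift_ι_apply, xDeg_mul, x_comm c Z i j hij h]
      exact (DirectSum.lof 𝕜 ℕ (fun d => grading c Z d) (1 + 1)).map_smul (c i j : 𝕜)
        ⟨x c Z j * x c Z i, SetLike.mul_mem_graded (x_mem c Z j) (x_mem c Z i)⟩
    | zero i j hij h =>
      simp only [map_mul, FreeAlgebra.lift_ι_apply, map_zero, xDeg_mul, x_zero c Z i j hij h]
      exact map_zero _⟩

theorem toDirectSum_x (i : Fin n) : toDirectSum c Z (x c Z i) = xDeg c Z i := by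
  simp [toDirectSum, x]

instance gradedAlgebra : GradedAlgebra (grading c Z) :=
  GradedAlgebra.ofAlgHom _ (toDirectSum c Z)
    (by
      apply RingQuot.ringQuot_ext'
      ext i
      change DirectSum.coeAlgHom (grading c Z) (toDirectSum c Z (x c Z i)) = x c Z i
      rw [toDirectSum_x, xDeg, DirectSum.coeAlgHom_of])
    fun i y => by
    obtain ⟨y, hy⟩ := y
    dsimp only [Subtype.coe_mk]
    induction hy using Submodule.pow_induction_on_left' with
    | algebraMap r =>
      rw [AlgHom.commutes, DirectSum.algebraMap_apply]; rfl
    | add x y i hx hy ihx ihy =>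
      rw [map_add, ihx, ihy, ← map_add]
      rfl
    | mem_mul m hm i y hy ih =>
      have hm1 : toDirectSum c Z m = DirectSum.of (fun d => grading c Z d) 1
          ⟨m, by simpa [grading] using hm⟩ := by
        induction hm using Submodule.span_induction with
        | mem m h => obtain ⟨i, rfl⟩ := h; exact toDirectSum_x c Z i
        | zero => rw [map_zero]; exact (map_zero _).symm
        | add a b ha hb iha ihb => rw [map_add, iha, ihb, ← map_add]; rfl
        | smul r a ha iha =>
          rw [map_smul, iha]
          exact ((DirectSum.lof 𝕜 ℕ (fun d => grading c Z d) 1).map_smul r _).symm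
      rw [map_mul, ih, hm1, DirectSum.of_mul_of]
      exact DirectSum.of_eq_of_gradedMonoid_eq (Sigma.subtype_ext (add_comm _ _) rfl)
end
end SkewAlg

/-! The increasing products `xs S`, over sets `S` of indices, form a basis, and the product of `xs
S` and `xs T` is `lam μ S T` times `xs (S ∪ T)`. The coefficient is multiplicative in disjoint
unions. Only two properties of `μ` enter the homological argument: `μ s s = 0`, and `μ s t = 1` for
`s < t`.

Let `I_m` be the right ideal spanned by the `xs S` such that `S` has an element below `m`. Left
multiplication by `x_m` induces an isomorphism from `A / I_{m+1}`, shifted by one degree, onto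
`I_{m+1} / I_m`: if `S` has no element below `m + 1`, it sends `xs S` to the basis vector `xs ({m} ∪
S)`; otherwise the product is zero or lies in `I_m`. Thus the `I_m` form a Koszul filtration.

Induction on the homological degree `i` proves that `Ext^i(A / I_m, 𝕜)` lives in internal degree `i`
for all `m` (`QuotExact`). The filtration then gives that `Ext^i(I_m, 𝕜)` lives in degree `i + 1`
(`idealExact_of_quotExact`), and since `A` is free, `Ext^i(I_m, 𝕜)` surjects onto `Ext^{i+1}(A /
I_m, 𝕜)` (`quotExact_succ`). Taking `m = n` gives `A / I_n = 𝕜` (`exists_bd_eq`).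

Cochains are functions on words of sets. For the modules above, the first letter indexes a basis
vector of the module and may be empty; the other letters are nonempty. -/

namespace SkewAlg

/-! ### Structure constants and the cobar complex on words -/

section Combinatorics

variable {𝕜 : Type*} [Field 𝕜] {n : ℕ}

/-- The coefficient of `x_{S ∪ T}` in `x_S x_T`, given the coefficients `μ s t` for generators. -/
def lam (μ : Fin n → Fin n → 𝕜) (S T : Finset (Fin n)) : 𝕜 := ∏ s ∈ S, ∏ t ∈ T, μ s t

variable (μ : Fin n → Fin n → 𝕜)

@[simp] theorem lam_empty_left (T : Finset (Fin n)) : lam μ ∅ T = 1 := by simp [lam]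

@[simp] theorem lam_empty_right (T : Finset (Fin n)) : lam μ T ∅ = 1 := by simp [lam]

theorem lam_union_left {S T : Finset (Fin n)} (U : Finset (Fin n)) (h : Disjoint S T) :
    lam μ (S ∪ T) U = lam μ S U * lam μ T U := Finset.prod_union h

theorem lam_union_right (U : Finset (Fin n)) {S T : Finset (Fin n)} (h : Disjoint S T) :
    lam μ U (S ∪ T) = lam μ U S * lam μ U T := by
  simp [lam, Finset.prod_union h, Finset.prod_mul_distrib]

theorem lam_eq_one_of_lt (h1 : ∀ s t, s < t → μ s t = 1) {S T : Finset (Fin n)}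
    (h : ∀ s ∈ S, ∀ t ∈ T, s < t) : lam μ S T = 1 :=
  Finset.prod_eq_one fun s hs => Finset.prod_eq_one fun t ht => h1 s t (h s hs t ht)

variable {μ}

theorem lam_of_mem_of_mem (h0 : ∀ s, μ s s = 0) {S T : Finset (Fin n)} {s : Fin n} (hS : s ∈ S)
    (hT : s ∈ T) : lam μ S T = 0 :=
  Finset.prod_eq_zero hS (Finset.prod_eq_zero hT (h0 s))

theorem lam_of_not_disjoint (h0 : ∀ s, μ s s = 0) {S T : Finset (Fin n)} (h : ¬ Disjoint S T) :
    lam μ S T = 0 := by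
  obtain ⟨s, hs, ht⟩ := Finset.not_disjoint_iff.1 h
  exact lam_of_mem_of_mem h0 hs ht

/-- This is associativity of the product on the `xs S`. For disjoint sets it is bimultiplicativity
of `lam`; an overlap makes both sides vanish. -/
theorem lam_assoc (h0 : ∀ s, μ s s = 0) (S T U : Finset (Fin n)) :
    lam μ S T * lam μ (S ∪ T) U = lam μ T U * lam μ S (T ∪ U) := by
  by_cases h : Disjoint S T
  · by_cases h' : Disjoint T U
    · rw [lam_union_left μ U h, lam_union_right μ S h']; ring
    · rw [lam_union_left μ U h, lam_of_not_disjoint h0 h']; ring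
  · rw [lam_of_not_disjoint h0 h, lam_of_not_disjoint h0 (S := S) (T := T ∪ U)]
    · ring
    · exact fun h' => h (h'.mono_right Finset.subset_union_left)

/-- The differential of the cobar complex, on functions on words in the basis `x_S`. -/
def bd (μ : Fin n → Fin n → 𝕜) :
    (List (Finset (Fin n)) → 𝕜) → List (Finset (Fin n)) → 𝕜
  | _, [] => 0
  | _, [_] => 0
  | F, a :: b :: l => lam μ a b * F ((a ∪ b) :: l) - bd μ (fun l => F (a :: l)) (b :: l)

theorem bd_sub (F G : List (Finset (Fin n)) → 𝕜) (l : List (Finset (Fin n))) :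
    bd μ (fun l => F l - G l) l = bd μ F l - bd μ G l := by
  fun_induction bd μ F l generalizing G with
  | case1 => simp [bd]
  | case2 => simp [bd]
  | case3 F a b l ih => simp only [bd, ih]; ring

theorem bd_const_mul (r : 𝕜) (F : List (Finset (Fin n)) → 𝕜) (l : List (Finset (Fin n))) :
    bd μ (fun l => r * F l) l = r * bd μ F l := by
  fun_induction bd μ F l with
  | case1 => simp [bd]
  | case2 => simp [bd]
  | case3 F a b l ih => simp only [bd, ih]; ring

theorem bd_bd (h0 : ∀ s, μ s s = 0) (F : List (Finset (Fin n)) → 𝕜) (l : List (Finset (Fin n))) :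
    bd μ (bd μ F) l = 0 := by
  induction l generalizing F with
  | nil => rfl
  | cons a l ih =>
    match l with
    | [] => rfl
    | [b] => simp [bd]
    | b :: c :: l =>
      -- Separating the term that merges into `a` leaves a differential in the remaining letters, to
      -- which the induction hypothesis applies. The two ways of merging `a`, `b`, `c` then cancel
      -- by `lam_assoc`.
      have key : (fun l' => bd μ F (a :: l')) = fun l' =>
          (match l' with | [] => 0 | b :: l => lam μ a b * F ((a ∪ b) :: l)) -
            bd μ (fun l => F (a :: l)) l' := by
        funext l'
        cases l' <;> simp [bd]
      rw [bd, key, bd_sub, ih]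
      simp only [bd]
      rw [bd_const_mul, Finset.union_assoc]
      linear_combination F ((a ∪ (b ∪ c)) :: l) * lam_assoc h0 a b c

/-- Words of length `i` in nonempty sets. -/
def IsWord (i : ℕ) (l : List (Finset (Fin n))) : Prop := l.length = i ∧ ∀ T ∈ l, T.Nonempty

theorem isWord_cons {i : ℕ} {T : Finset (Fin n)} {l : List (Finset (Fin n))} :
    IsWord (i + 1) (T :: l) ↔ T.Nonempty ∧ IsWord i l := by
  simp [IsWord]; tauto

theorem IsWord.exists_cons {i : ℕ} {l : List (Finset (Fin n))} (h : IsWord (i + 1) l) :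
    ∃ T l', l = T :: l' ∧ T.Nonempty ∧ IsWord i l' := by
  cases l with
  | nil => simp [IsWord] at h
  | cons T l => exact ⟨T, l, rfl, isWord_cons.1 h⟩

theorem isWord_zero {l : List (Finset (Fin n))} : IsWord 0 l ↔ l = [] := by
  constructor
  · exact fun h => List.length_eq_zero_iff.1 h.1
  · rintro rfl; simp [IsWord]

/-- `bd F` on words with a first entry in the upward closed family `J` only depends on the values
of `F` on such words. -/
theorem bd_congr {J : Finset (Fin n) → Prop} {i : ℕ} {F G : List (Finset (Fin n)) → 𝕜}
    (hJ : ∀ S T, J S → lam μ S T ≠ 0 → T.Nonempty → J (S ∪ T))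
    (h : ∀ S l, J S → IsWord i l → F (S :: l) = G (S :: l))
    {S : Finset (Fin n)} {l : List (Finset (Fin n))} (hS : J S) (hl : IsWord (i + 1) l) :
    bd μ F (S :: l) = bd μ G (S :: l) := by
  induction i generalizing F G S l J with
  | zero =>
    obtain ⟨T, l, rfl, hT, hl⟩ := hl.exists_cons
    obtain rfl := isWord_zero.1 hl
    by_cases hab : lam μ S T = 0
    · simp [bd, hab]
    · simp [bd, h _ _ (hJ S T hS hab hT) hl]
  | succ i ih =>
    obtain ⟨T, l, rfl, hT, hl⟩ := hl.exists_cons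
    simp only [bd]
    rw [ih (J := fun T => T.Nonempty) (F := fun l => F (S :: l)) (G := fun l => G (S :: l))
      (fun S T hS _ _ => hS.mono Finset.subset_union_left)
      (fun T l hT hl => h S (T :: l) hS (isWord_cons.2 ⟨hT, hl⟩)) hT hl]
    by_cases hab : lam μ S T = 0
    · simp [hab]
    · rw [h _ _ (hJ S T hS hab hT) hl]

/-- The functions supported on words of total size `j`. -/
def HasDeg (i j : ℕ) (F : List (Finset (Fin n)) → 𝕜) : Prop :=
  ∀ l, l.length = i → (l.map Finset.card).sum ≠ j → F l = 0

theorem HasDeg.bd (h0 : ∀ s, μ s s = 0) {i j : ℕ} {F : List (Finset (Fin n)) → 𝕜}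
    (h : HasDeg i j F) : HasDeg (i + 1) j (bd μ F) := by
  induction i generalizing F j with
  | zero =>
    intro l hl _
    obtain ⟨a, rfl⟩ := List.length_eq_one_iff.1 hl
    rfl
  | succ i ih =>
    intro l hl hd
    match l, hl with
    | a :: b :: l, hl =>
      simp only [List.length_cons, Nat.add_right_cancel_iff] at hl
      simp only [List.map_cons, List.sum_cons] at hd
      rw [SkewAlg.bd]
      have h1 : lam μ a b * F ((a ∪ b) :: l) = 0 := by
        by_cases hab : Disjoint a b
        · rw [h _ (by simp [hl]), mul_zero]
          simp only [List.map_cons, List.sum_cons, Finset.card_union_of_disjoint hab]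
          omega
        · rw [lam_of_not_disjoint h0 hab, zero_mul]
      rw [h1, zero_sub, neg_eq_zero]
      by_cases hj : a.card ≤ j
      · refine ih (j := j - a.card) (fun l' hl' hd' => h _ (by simp [hl']) ?_) _ (by simp [hl]) ?_
        · simp only [List.map_cons, List.sum_cons]; omega
        · simp only [List.map_cons, List.sum_cons]; omega
      -- Here `a` alone exceeds the degree, so `F (a :: ·)` vanishes on all words of the relevant
      -- length and has every degree; any degree other than that of `b :: l` serves.
      · refine ih (j := (b.card + (l.map Finset.card).sum) + 1)
          (fun l' hl' hd' => h _ (by simp [hl']) ?_) _ (by simp [hl]) ?_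
        · simp only [List.map_cons, List.sum_cons]; omega
        · simp only [List.map_cons, List.sum_cons]; omega

/-! ### The Koszul filtration by the ideals `Low m` -/

/-- The ideal of sets with an element below `m`. -/
def Low (m : ℕ) (S : Finset (Fin n)) : Prop := ∃ s ∈ S, (s : ℕ) < m

theorem Low.union_left {m : ℕ} {S : Finset (Fin n)} (h : Low m S) (T : Finset (Fin n)) :
    Low m (S ∪ T) := by
  obtain ⟨s, hs, hm⟩ := h
  exact ⟨s, Finset.mem_union_left _ hs, hm⟩

theorem Low.union_right {m : ℕ} {T : Finset (Fin n)} (h : Low m T) (S : Finset (Fin n)) :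
    Low m (S ∪ T) := by
  rw [Finset.union_comm]; exact h.union_left S

/-- Cocycles on the quotient by the sets with an element below `m` are coboundaries, away from the
diagonal. -/
def QuotExact (μ : Fin n → Fin n → 𝕜) (i : ℕ) : Prop :=
  ∀ (m j : ℕ) (F : List (Finset (Fin n)) → 𝕜), j ≠ i → HasDeg (i + 1) j F →
    (∀ S l, IsWord i l → Low m S → F (S :: l) = 0) →
    (∀ S l, IsWord (i + 1) l → bd μ F (S :: l) = 0) →
    ∃ G, HasDeg i j G ∧ (∀ S l, l.length + 1 = i → IsWord l.length l → Low m S → G (S :: l) = 0) ∧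
      ∀ S l, IsWord i l → bd μ G (S :: l) = F (S :: l)

/-- Cocycles on the ideal of sets with an element below `m` are coboundaries, away from the
diagonal. -/
def IdealExact (μ : Fin n → Fin n → 𝕜) (i m : ℕ) : Prop :=
  ∀ (j : ℕ) (F : List (Finset (Fin n)) → 𝕜), j ≠ i + 1 → HasDeg (i + 1) j F →
    (∀ S l, IsWord (i + 1) l → Low m S → bd μ F (S :: l) = 0) →
    ∃ G, HasDeg i j G ∧ ∀ S l, IsWord i l → Low m S → bd μ G (S :: l) = F (S :: l)

theorem bd_zero (l : List (Finset (Fin n))) : bd μ (fun _ => 0) l = 0 := by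
  simpa using bd_const_mul (μ := μ) 0 (fun _ => 0) l

theorem HasDeg.sub {i j : ℕ} {F G : List (Finset (Fin n)) → 𝕜} (hF : HasDeg i j F)
    (hG : HasDeg i j G) : HasDeg i j (fun l => F l - G l) := fun l hl hd => by
  simp [hF l hl hd, hG l hl hd]

/-- Left multiplication by `x_e` is a map of right modules from `A / I_{e+1}` to `I_{e+1} / I_e`, so
pulling cochains back along it commutes with the differential. No scalar appears because `e`
precedes every element of `S`. -/
theorem bd_insert (h0 : ∀ s, μ s s = 0) (h1 : ∀ s t, s < t → μ s t = 1) {i : ℕ} {e : Fin n}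
    {A B : List (Finset (Fin n)) → 𝕜}
    (hA : ∀ S l, IsWord i l → Low e S → A (S :: l) = 0)
    (hB : ∀ S l, IsWord i l → Low (e + 1) S → B (S :: l) = 0)
    (hAB : ∀ S l, ¬ Low (e + 1) S → A (({e} ∪ S) :: l) = B (S :: l))
    {S : Finset (Fin n)} {l : List (Finset (Fin n))} (hS : ¬ Low (e + 1) S)
    (hl : IsWord (i + 1) l) :
    bd μ A (({e} ∪ S) :: l) = bd μ B (S :: l) := by
  obtain ⟨T, l, rfl, hT, hl⟩ := hl.exists_cons
  simp only [bd, fun l => hAB S l hS, sub_left_inj]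
  have hlam : ∀ U : Finset (Fin n), ¬ Low (e + 1) U → lam μ {e} U = 1 := fun U hU =>
    lam_eq_one_of_lt μ h1 fun s hs t ht => by
      obtain rfl := Finset.mem_singleton.1 hs
      by_contra hst
      exact hU ⟨t, ht, by have := not_lt.1 hst; simp only [Fin.le_def] at this; omega⟩
  -- If `T` contains `e`, the product vanishes because `x_e` squares to zero; if `T` has an element
  -- below `e`, the product falls in `I_e`, where `A` vanishes.
  by_cases hT' : Low (e + 1) T
  · rw [hB _ _ hl (hT'.union_right S), mul_zero]
    obtain ⟨t, ht, hte⟩ := hT'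
    by_cases h : t = e
    · subst h
      rw [lam_of_mem_of_mem h0 (s := t) (by simp) ht, zero_mul]
    · rw [hA _ _ hl, mul_zero]
      exact Low.union_right ⟨t, ht, by have := Fin.val_ne_of_ne h; omega⟩ _
  · have hST : ¬ Low (e + 1) (S ∪ T) := by
      rintro ⟨s, hs, hse⟩
      rcases Finset.mem_union.1 hs with hs | hs
      · exact hS ⟨s, hs, hse⟩
      · exact hT' ⟨s, hs, hse⟩
    rw [Finset.union_assoc, hAB _ _ hST]
    have := lam_assoc h0 {e} S T
    rw [hlam S hS, hlam _ hST] at this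
    rw [← one_mul (lam μ ({e} ∪ S) T), this, mul_one]

/-- This is the long exact sequence of `0 → I_m → I_{m+1} → (A / I_{m+1})(-1) → 0`, made explicit on
cochains. A primitive on `I_m` is subtracted, and the remainder is a cocycle on the quotient. -/
theorem idealExact_of_quotExact (h0 : ∀ s, μ s s = 0) (h1 : ∀ s t, s < t → μ s t = 1) {i : ℕ}
    (hq : QuotExact μ i) (m : ℕ) : IdealExact μ i m := by
  classical
  induction m with
  | zero =>
    intro j F _ _ _
    refine ⟨fun _ => 0, fun _ _ _ => rfl, ?_⟩
    rintro S l _ ⟨s, _, hs⟩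
    omega
  | succ m ih =>
    intro j F hj hdeg hclosed
    obtain ⟨G₁, hG₁, hbd₁⟩ := ih j F hj hdeg fun S l hl ⟨s, hs, hsm⟩ =>
      hclosed S l hl ⟨s, hs, by omega⟩
    by_cases hm : m < n
    swap
    · exact ⟨G₁, hG₁, fun S l hl ⟨s, hs, _⟩ => hbd₁ S l hl ⟨s, hs, by omega⟩⟩
    let e : Fin n := ⟨m, hm⟩
    let K : List (Finset (Fin n)) → 𝕜 := fun l => F l - bd μ G₁ l
    have hK : HasDeg (i + 1) j K := hdeg.sub (hG₁.bd h0)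
    have hKlow : ∀ S l, IsWord i l → Low m S → K (S :: l) = 0 := fun S l hl hS => by
      simp [K, hbd₁ S l hl hS]
    have hKclosed : ∀ S l, IsWord (i + 1) l → Low (m + 1) S → bd μ K (S :: l) = 0 :=
      fun S l hl hS => by simp [K, bd_sub, bd_bd h0, hclosed S l hl hS]
    have hecard : ∀ S : Finset (Fin n), ¬ Low (m + 1) S → ({e} ∪ S).card = S.card + 1 := by
      intro S hS
      rw [← Finset.insert_eq, Finset.card_insert_of_notMem]
      exact fun h => hS ⟨e, h, by simp [e]⟩
    -- The remainder `K`, pulled back to `A / I_{m+1}` along left multiplication by `x_m`.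
    let F' : List (Finset (Fin n)) → 𝕜 := fun l => match l with
      | [] => 0
      | S :: l => if Low (m + 1) S then 0 else K (({e} ∪ S) :: l)
    have hF'K : ∀ S l, ¬ Low (m + 1) S → K (({e} ∪ S) :: l) = F' (S :: l) := fun S l hS => by
      simp [F', hS]
    have hF'low : ∀ S l, Low (m + 1) S → F' (S :: l) = 0 := fun S l hS => by simp [F', hS]
    have hF'closed : ∀ S l, IsWord (i + 1) l → bd μ F' (S :: l) = 0 := by
      intro S l hl
      by_cases hS : Low (m + 1) S
      · rw [bd_congr (J := Low (m + 1)) (G := fun _ => 0) (fun S T h _ _ => h.union_left T)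
          (fun S l hS _ => hF'low S l hS) hS hl, bd_zero]
      · rw [← bd_insert h0 h1 (e := e) hKlow (fun S l _ => hF'low S l) hF'K hS hl]
        exact hKclosed _ _ hl ⟨e, by simp, by simp [e]⟩
    -- The shift to degree `j - 1` needs `j > 0`. In degree zero `F` already vanishes on `I_{m+1}`,
    -- whose basis sets are nonempty.
    by_cases hj0 : j = 0
    · refine ⟨fun _ => 0, fun _ _ _ => rfl, ?_⟩
      rintro S l hl ⟨s, hs, -⟩
      rw [bd_zero, hdeg _ (by simp [hl.1])]
      have := Finset.card_pos.2 ⟨s, hs⟩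
      simp only [List.map_cons, List.sum_cons]
      omega
    have hF' : HasDeg (i + 1) (j - 1) F' := by
      rintro (_ | ⟨S, l⟩) hl hd
      · rfl
      · by_cases hS : Low (m + 1) S
        · exact hF'low S l hS
        · rw [← hF'K S l hS]
          refine hK _ (by simpa using hl) ?_
          simp only [List.map_cons, List.sum_cons, hecard S hS] at hd ⊢
          omega
    obtain ⟨G', hG', hG'low, hbd'⟩ := hq (m + 1) (j - 1) F' (by omega) hF'
      (fun S l _ => hF'low S l) hF'closed
    -- The primitive `G'` carried back to `I_{m+1} / I_m` by removing `e`, and extended by zero.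
    let G₂ : List (Finset (Fin n)) → 𝕜 := fun l => match l with
      | [] => 0
      | S :: l => if Low m S ∨ e ∉ S then 0 else G' (S.erase e :: l)
    have hlow_iff : ∀ S : Finset (Fin n), Low (m + 1) S ↔ Low m S ∨ e ∈ S := by
      intro S
      constructor
      · rintro ⟨s, hs, hsm⟩
        rcases Nat.lt_succ_iff_lt_or_eq.1 hsm with h | h
        · exact Or.inl ⟨s, hs, h⟩
        · exact Or.inr ((Fin.ext h : s = e) ▸ hs)
      · rintro (⟨s, hs, hsm⟩ | h)
        · exact ⟨s, hs, by omega⟩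
        · exact ⟨e, h, by simp [e]⟩
    have hdecomp : ∀ S : Finset (Fin n), ¬ Low m S → e ∈ S →
        ¬ Low (m + 1) (S.erase e) ∧ {e} ∪ S.erase e = S := by
      intro S hS he
      refine ⟨?_, by rw [← Finset.insert_eq, Finset.insert_erase he]⟩
      rw [hlow_iff]
      rintro (⟨s, hs, h⟩ | h)
      · exact hS ⟨s, Finset.mem_of_mem_erase hs, h⟩
      · simp at h
    have hG₂low : ∀ S l, Low m S → G₂ (S :: l) = 0 := fun S l hS => by simp [G₂, hS]
    have hG₂G' : ∀ S l, ¬ Low (m + 1) S → G₂ (({e} ∪ S) :: l) = G' (S :: l) := by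
      intro S l hS
      have he : e ∉ S := fun h => hS ((hlow_iff S).2 (Or.inr h))
      have hm : ¬ Low m ({e} ∪ S) := by
        rintro ⟨s, hs, h⟩
        rcases Finset.mem_union.1 hs with hs | hs
        · obtain rfl := Finset.mem_singleton.1 hs
          simp [e] at h
        · exact hS ⟨s, hs, by omega⟩
      have : ({e} ∪ S).erase e = S := by rw [← Finset.insert_eq, Finset.erase_insert he]
      have h : ¬ (Low m ({e} ∪ S) ∨ e ∉ {e} ∪ S) := by
        rintro (h | h)
        · exact hm h
        · simp at h
      simp only [G₂, this, if_neg h]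
    -- The sum of the two primitives, written so that `bd_sub` and `bd_const_mul` apply.
    refine ⟨fun l => G₁ l - -1 * G₂ l, hG₁.sub ?_, ?_⟩
    · rintro (_ | ⟨S, l⟩) hl hd
      · simp [G₂]
      · dsimp only
        by_cases hS : Low m S ∨ e ∉ S
        · simp [G₂, hS]
        · push Not at hS
          obtain ⟨h2, h3⟩ := hdecomp S hS.1 hS.2
          rw [← h3, hG₂G' _ _ h2, hG' _ (by simpa using hl), mul_zero]
          rw [← h3] at hd
          simp only [List.map_cons, List.sum_cons, hecard _ h2] at hd ⊢
          omega
    · intro S l hl hS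
      rw [bd_sub, bd_const_mul]
      suffices bd μ G₂ (S :: l) = K (S :: l) by rw [this]; simp only [K]; ring
      by_cases hSm : Low m S
      · rw [hKlow S l hl hSm]
        cases i with
        | zero => obtain rfl := isWord_zero.1 hl; rfl
        | succ i =>
          rw [bd_congr (J := Low m) (G := fun _ => 0) (fun S T h _ _ => h.union_left T)
            (fun S l hS _ => hG₂low S l hS) hSm hl, bd_zero]
      · obtain ⟨h2, h3⟩ := hdecomp S hSm (((hlow_iff S).1 hS).resolve_left hSm)
        rw [← h3, hF'K _ _ h2, ← hbd' _ _ hl]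
        cases i with
        | zero => obtain rfl := isWord_zero.1 hl; rfl
        | succ i =>
          exact bd_insert h0 h1 (e := e) (fun S l _ => hG₂low S l)
            (fun S l hl => hG'low S l (by rw [hl.1]) (by rwa [hl.1])) hG₂G' h2 hl

/-- A homomorphism from a quotient of `A` to `𝕜` is determined by its value at `1`. Closedness at
the word `∅, S` is the statement that `F` kills `xs S` for nonempty `S`. -/
theorem quotExact_zero : QuotExact μ 0 := by
  intro m j F hj hdeg _ hclosed
  refine ⟨fun _ => 0, fun _ _ _ => rfl, fun _ _ _ _ _ => rfl, ?_⟩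
  intro S l hl
  obtain rfl := isWord_zero.1 hl
  rw [bd_zero]
  rcases S.eq_empty_or_nonempty with rfl | hS
  · exact (hdeg _ rfl (by simpa using hj.symm)).symm
  · have := hclosed ∅ [S] (by simpa [IsWord] using hS)
    simpa [bd] using this.symm

/-- The bar complex of the free module `A` is contracted by inserting `1` in front, so `F` has a
primitive `H` on `A`. As `F` vanishes on `I_m`, the restriction of `H` to `I_m` is a cocycle;
subtracting `bd μ G`, where `G` is a primitive of that restriction, makes `H` vanish there and does
not change `bd μ H`. -/
theorem quotExact_succ (h0 : ∀ s, μ s s = 0) {i : ℕ} (hI : ∀ m, IdealExact μ i m) :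
    QuotExact μ (i + 1) := by
  classical
  intro m j F hj hdeg hlow hclosed
  let H : List (Finset (Fin n)) → 𝕜 := fun l => match l with
    | [] => 0
    | S :: l => if S.Nonempty then F (∅ :: S :: l) else 0
  have hHF : ∀ S l, S.Nonempty → H (S :: l) = F (∅ :: S :: l) := fun S l hS => by simp [H, hS]
  have hH : HasDeg (i + 1) j H := by
    rintro (_ | ⟨S, l⟩) hl hd
    · rfl
    · by_cases hS : S.Nonempty
      · rw [hHF S l hS, hdeg _ (by simpa using hl) (by simpa using hd)]
      · simp [H, hS]
  have hbd : ∀ S l, IsWord (i + 1) l → bd μ H (S :: l) = F (S :: l) := by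
    intro S l hl
    rcases S.eq_empty_or_nonempty with rfl | hS
    · obtain ⟨T, l, rfl, hT, hl⟩ := hl.exists_cons
      have h2 : (fun l => H (∅ :: l)) = fun _ => 0 := by funext l; simp [H]
      rw [bd, h2, bd_zero, lam_empty_left, Finset.empty_union, hHF T l hT]
      ring
    · have h2 := hclosed ∅ (S :: l) (isWord_cons.2 ⟨hS, hl⟩)
      rw [bd, lam_empty_left, Finset.empty_union] at h2
      rw [bd_congr (J := fun S => S.Nonempty) (G := fun l => F (∅ :: l))
        (fun S T hS _ _ => hS.mono Finset.subset_union_left) (fun S l hS _ => hHF S l hS) hS hl]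
      linear_combination -h2
  obtain ⟨G, hG, hGbd⟩ := hI m j H hj hH fun S l hl hS => by rw [hbd S l hl, hlow S l hl hS]
  refine ⟨fun l => H l - bd μ G l, hH.sub (hG.bd h0), ?_, ?_⟩
  · intro S l hl hw hS
    obtain rfl : l.length = i := by omega
    dsimp only
    rw [hGbd S l hw hS, sub_self]
  · intro S l hl
    rw [bd_sub, bd_bd h0, sub_zero, hbd S l hl]

theorem quotExact (h0 : ∀ s, μ s s = 0) (h1 : ∀ s t, s < t → μ s t = 1) (i : ℕ) :
    QuotExact μ i := by
  induction i with
  | zero => exact quotExact_zero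
  | succ i ih => exact quotExact_succ h0 (idealExact_of_quotExact h0 h1 ih)

/-- The cobar complex on words in the basis is exact off the diagonal. -/
theorem exists_bd_eq (h0 : ∀ s, μ s s = 0) (h1 : ∀ s t, s < t → μ s t = 1) {i j : ℕ}
    (hij : j ≠ i) (F : List (Finset (Fin n)) → 𝕜) (hdeg : HasDeg i j F)
    (hclosed : ∀ l, IsWord (i + 1) l → bd μ F l = 0) :
    ∃ G, (∀ k, k + 1 = i → HasDeg k j G) ∧ ∀ l, IsWord i l → bd μ G l = F l := by
  classical
  -- A cochain for `𝕜 = A / I_n`: only the empty first letter survives. Prepending that letter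
  -- changes the sign of the differential, hence the factor `-1` in the primitive below.
  let F' : List (Finset (Fin n)) → 𝕜 := fun l => match l with
    | [] => 0
    | S :: l => if S = ∅ then F l else 0
  have hF'e : (fun l => F' (∅ :: l)) = F := by funext l; simp [F']
  have hF'n : ∀ S l, S.Nonempty → F' (S :: l) = 0 := fun S l hS => by simp [F', hS.ne_empty]
  obtain ⟨G, hG, hGlow, hGbd⟩ := quotExact h0 h1 i n j F' hij
    (by
      rintro (_ | ⟨S, l⟩) hl hd
      · rfl
      · rcases S.eq_empty_or_nonempty with rfl | hS
        · rw [← hdeg l (by simpa using hl) (by simpa using hd)]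
          simp [F']
        · exact hF'n S l hS)
    (fun S l _ ⟨s, hs, _⟩ => hF'n S l ⟨s, hs⟩)
    (by
      intro S l hl
      rcases S.eq_empty_or_nonempty with rfl | hS
      · obtain ⟨T, l, rfl, hT, hl'⟩ := hl.exists_cons
        rw [bd, hF'e, hclosed _ hl, lam_empty_left, Finset.empty_union, hF'n T l hT]
        ring
      · rw [bd_congr (J := fun S => S.Nonempty) (G := fun _ => 0)
          (fun S T hS _ _ => hS.mono Finset.subset_union_left) (fun S l hS _ => hF'n S l hS) hS hl,
          bd_zero])
  have hbd : ∀ l, IsWord i l → bd μ (fun l => -1 * G (∅ :: l)) l = F l := by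
    intro l hl
    have h2 := hGbd ∅ l hl
    rw [congrFun hF'e l] at h2
    rw [← h2, bd_const_mul]
    cases i with
    | zero => obtain rfl := isWord_zero.1 hl; simp [bd]
    | succ i =>
      obtain ⟨T, l, rfl, hT, hl'⟩ := hl.exists_cons
      obtain ⟨s, hs⟩ := hT
      have h3 : bd μ G (∅ :: T :: l) = lam μ ∅ T * G ((∅ ∪ T) :: l) -
        bd μ (fun l => G (∅ :: l)) (T :: l) := rfl
      rw [h3, lam_empty_left, Finset.empty_union,
        hGlow T l (by rw [hl'.1]) (by rwa [hl'.1]) ⟨s, hs, s.2⟩]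
      ring
  refine ⟨fun l => -1 * G (∅ :: l), ?_, hbd⟩
  rintro k rfl l hl hd
  dsimp only
  rw [hG _ (by simpa using hl) (by simpa using hd), mul_zero]

end Combinatorics
end SkewAlg

namespace SkewAlg

/-! ### The PBW basis of the algebra -/

section Basis

variable {𝕜 : Type*} [Field 𝕜] {n : ℕ} (c : Fin n → Fin n → 𝕜ˣ) (Z : Fin n → Fin n → Prop)

open Classical in
/-- The scalar in `x_s x_t = μ s t • x_{\{s, t\}}`. -/
noncomputable def mu (s t : Fin n) : 𝕜 :=
  if s < t then 1 else if t < s ∧ ¬ Z s t then ((c t s)⁻¹ : 𝕜ˣ) else 0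

theorem mu_self (s : Fin n) : mu c Z s s = 0 := by simp [mu]

theorem mu_of_lt (s t : Fin n) (h : s < t) : mu c Z s t = 1 := by simp [mu, h]

theorem mu_of_gt {s t : Fin n} (h : t < s) (hZ : ¬ Z s t) :
    mu c Z s t = ((c t s)⁻¹ : 𝕜ˣ) := by simp [mu, h, h.not_gt, hZ]

theorem mu_of_gt_of_zero {s t : Fin n} (h : t < s) (hZ : Z s t) : mu c Z s t = 0 := by
  simp [mu, h.not_gt, hZ]

@[simp] theorem lam_singleton (μ : Fin n → Fin n → 𝕜) (s t : Fin n) : lam μ {s} {t} = μ s t := by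
  simp [lam]

/-- The action of `x_i` on the space with basis the subsets of `Fin n`. -/
noncomputable def actX (i : Fin n) : Module.End 𝕜 (Finset (Fin n) →₀ 𝕜) :=
  Finsupp.linearCombination 𝕜 fun S => Finsupp.single ({i} ∪ S) (lam (mu c Z) {i} S)

theorem actX_single (i : Fin n) (S : Finset (Fin n)) (r : 𝕜) :
    actX c Z i (Finsupp.single S r) = Finsupp.single ({i} ∪ S) (r * lam (mu c Z) {i} S) := by
  simp [actX]

/-- Apart from `mu c Z i j` the result is symmetric in `i` and `j`, so each defining relation
reduces to an identity between scalars `mu`. -/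
theorem actX_actX_single (i j : Fin n) (S : Finset (Fin n)) :
    actX c Z i (actX c Z j (Finsupp.single S 1)) =
      Finsupp.single ({i} ∪ {j} ∪ S) (mu c Z i j * lam (mu c Z) ({i} ∪ {j}) S) := by
  rw [actX_single, actX_single, one_mul, ← lam_assoc (mu_self c Z), lam_singleton,
    Finset.union_assoc]

/-- The representation of the algebra on the space with basis the subsets of `Fin n`. -/
noncomputable def rep : Alg c Z →ₐ[𝕜] Module.End 𝕜 (Finset (Fin n) →₀ 𝕜) :=
  RingQuot.liftAlgHom 𝕜 ⟨FreeAlgebra.lift 𝕜 (actX c Z), by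
    intro a b hab
    cases hab with
    | sq i =>
      simp only [map_mul, FreeAlgebra.lift_ι_apply, map_zero]
      refine Finsupp.lhom_ext' fun S => LinearMap.ext_ring ?_
      simp only [LinearMap.comp_apply, Finsupp.lsingle_apply, Module.End.mul_apply,
        actX_actX_single, mu_self, zero_mul, Finsupp.single_zero, LinearMap.zero_apply]
    | comm i j hij h =>
      simp only [map_mul, map_smul, FreeAlgebra.lift_ι_apply]
      refine Finsupp.lhom_ext' fun S => LinearMap.ext_ring ?_
      simp only [LinearMap.comp_apply, Finsupp.lsingle_apply, Module.End.mul_apply,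
        actX_actX_single, LinearMap.smul_apply, mu_of_lt c Z i j hij, mu_of_gt c Z hij h,
        Finset.union_comm {j} {i}, Finsupp.smul_single, smul_eq_mul, ← mul_assoc, Units.mul_inv]
    | zero i j hij h =>
      simp only [map_mul, FreeAlgebra.lift_ι_apply, map_zero]
      refine Finsupp.lhom_ext' fun S => LinearMap.ext_ring ?_
      simp only [LinearMap.comp_apply, Finsupp.lsingle_apply, Module.End.mul_apply,
        actX_actX_single, mu_of_gt_of_zero c Z hij h, zero_mul, Finsupp.single_zero,
        LinearMap.zero_apply]⟩

theorem rep_x (i : Fin n) : rep c Z (x c Z i) = actX c Z i := by simp [rep, x]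

/-- The increasing product `x_S` of the generators in `S`. -/
noncomputable def xs (S : Finset (Fin n)) : Alg c Z := (S.sort.map (x c Z)).prod

@[simp] theorem xs_empty : xs c Z ∅ = 1 := by simp [xs]

theorem xs_insert {i : Fin n} {S : Finset (Fin n)} (h : ∀ s ∈ S, i < s) :
    xs c Z ({i} ∪ S) = x c Z i * xs c Z S := by
  rw [xs, ← Finset.insert_eq, Finset.sort_insert _ (fun s hs => (h s hs).le)
    (fun hi => lt_irrefl _ (h i hi))]
  simp [xs]

theorem x_mul_x_of_gt {i m : Fin n} (h : m < i) :
    x c Z i * x c Z m = mu c Z i m • (x c Z m * x c Z i) := by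
  by_cases hZ : Z i m
  · rw [x_zero c Z m i h hZ, mu_of_gt_of_zero c Z h hZ, zero_smul]
  · rw [x_comm c Z m i h hZ, mu_of_gt c Z h hZ, smul_smul, Units.inv_mul, one_smul]

/-- Straightening: `x_i` moves right past the smaller generators, picking up the factors `mu`, until
it finds its place or meets itself. -/
theorem x_mul_xs (i : Fin n) (S : Finset (Fin n)) :
    x c Z i * xs c Z S = lam (mu c Z) {i} S • xs c Z ({i} ∪ S) := by
  induction S using Finset.induction_on_min with
  | empty => rw [lam_empty_right, one_smul, xs_insert]; simp
  | insert m S hm ih =>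
    rw [Finset.insert_eq]
    rcases lt_trichotomy i m with h | rfl | h
    · have h2 : ∀ s ∈ ({m} ∪ S : Finset (Fin n)), i < s := by
        intro s hs
        rcases Finset.mem_union.1 hs with hs | hs
        · rwa [Finset.mem_singleton.1 hs]
        · exact h.trans (hm s hs)
      rw [xs_insert c Z h2, lam_eq_one_of_lt _ (mu_of_lt c Z), one_smul]
      intro s hs t ht
      rw [Finset.mem_singleton.1 hs]
      exact h2 t ht
    · rw [xs_insert c Z hm, ← mul_assoc, x_sq, zero_mul,
        lam_of_mem_of_mem (mu_self c Z) (s := i) (by simp) (by simp), zero_smul]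
    · have hmS : Disjoint {m} S := by
        rw [Finset.disjoint_singleton_left]
        exact fun h => lt_irrefl _ (hm m h)
      have h2 : ∀ s ∈ ({i} ∪ S : Finset (Fin n)), m < s := by
        intro s hs
        rcases Finset.mem_union.1 hs with hs | hs
        · rwa [Finset.mem_singleton.1 hs]
        · exact hm s hs
      rw [xs_insert c Z hm, ← mul_assoc, x_mul_x_of_gt c Z h, smul_mul_assoc, mul_assoc, ih,
        mul_smul_comm, ← xs_insert c Z h2, smul_smul, lam_union_right _ _ hmS, lam_singleton,
        Finset.union_left_comm]

theorem xs_mul_xs (S T : Finset (Fin n)) :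
    xs c Z S * xs c Z T = lam (mu c Z) S T • xs c Z (S ∪ T) := by
  induction S using Finset.induction_on_min with
  | empty => simp
  | insert m S hm ih =>
    have h := lam_assoc (mu_self c Z) {m} S T
    rw [lam_eq_one_of_lt _ (mu_of_lt c Z) (by simpa using hm), one_mul] at h
    rw [Finset.insert_eq, xs_insert c Z hm, mul_assoc, ih, mul_smul_comm, x_mul_xs, smul_smul, h,
      Finset.union_assoc]

/-- The coordinates in the basis `x_S`. -/
noncomputable def coord : Alg c Z →ₗ[𝕜] Finset (Fin n) →₀ 𝕜 :=
  (LinearMap.applyₗ (Finsupp.single ∅ 1)).comp (rep c Z).toLinearMap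

/-- Building `S` from its largest element downwards, each generator acts with coefficient one. This
is what makes the `xs S` linearly independent. -/
theorem coord_xs (S : Finset (Fin n)) : coord c Z (xs c Z S) = Finsupp.single S 1 := by
  induction S using Finset.induction_on_min with
  | empty => simp [coord]
  | insert m S hm ih =>
    have h : rep c Z (xs c Z S) (Finsupp.single ∅ 1) = Finsupp.single S 1 := ih
    have h2 : coord c Z (x c Z m * xs c Z S) =
      rep c Z (x c Z m) (rep c Z (xs c Z S) (Finsupp.single ∅ 1)) := by simp [coord]
    rw [Finset.insert_eq, xs_insert c Z hm, h2, h, rep_x, actX_single,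
      lam_eq_one_of_lt _ (mu_of_lt c Z) (by simpa using hm), one_mul]

theorem xs_mem (S : Finset (Fin n)) : xs c Z S ∈ grading c Z S.card := by
  induction S using Finset.induction_on_min with
  | empty => rw [xs_empty]; exact SetLike.one_mem_graded (grading c Z)
  | insert m S hm ih =>
    rw [Finset.card_insert_of_notMem fun h => lt_irrefl _ (hm m h), Finset.insert_eq,
      xs_insert c Z hm, add_comm]
    exact SetLike.mul_mem_graded (x_mem c Z m) ih

theorem grading_le_span (d : ℕ) :
    grading c Z d ≤ Submodule.span 𝕜 (xs c Z '' {S | S.card = d}) := by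
  induction d with
  | zero =>
    rw [grading, pow_zero, Submodule.one_eq_span, Submodule.span_le, Set.singleton_subset_iff]
    exact Submodule.subset_span ⟨∅, by simp⟩
  | succ d ih =>
    rw [grading, pow_succ']
    refine (mul_le_mul' le_rfl ih).trans ?_
    rw [gens, Submodule.span_mul_span, Submodule.span_le]
    rintro _ ⟨_, ⟨i, rfl⟩, _, ⟨S, hS, rfl⟩, rfl⟩
    dsimp only
    rw [x_mul_xs]
    by_cases hi : i ∈ S
    · rw [lam_of_mem_of_mem (mu_self c Z) (s := i) (by simp) hi, zero_smul]
      exact Submodule.zero_mem _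
    · refine Submodule.smul_mem _ _ (Submodule.subset_span ⟨_, ?_, rfl⟩)
      rw [Set.mem_ofPred_eq, ← Finset.insert_eq, Finset.card_insert_of_notMem hi, hS]

theorem coord_of_mem {d : ℕ} {a : Alg c Z} (ha : a ∈ grading c Z d) {S : Finset (Fin n)}
    (hS : S.card ≠ d) : coord c Z a S = 0 := by
  have h := grading_le_span c Z d ha
  clear ha
  induction h using Submodule.span_induction with
  | mem a h =>
    obtain ⟨T, hT, rfl⟩ := h
    rw [coord_xs, Finsupp.single_eq_of_ne]
    rintro rfl
    exact hS hT
  | zero => simp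
  | add a b _ _ iha ihb => simp [iha, ihb]
  | smul r a _ iha => simp [iha]

theorem sum_coord (a : Alg c Z) : ∑ S, coord c Z a S • xs c Z S = a := by
  induction a using DirectSum.Decomposition.inductionOn (grading c Z) with
  | zero => simp
  | @homogeneous d a =>
    obtain ⟨a, ha⟩ := a
    dsimp only
    have h := grading_le_span c Z d ha
    clear ha
    induction h using Submodule.span_induction with
    | mem a h =>
      obtain ⟨T, hT, rfl⟩ := h
      simp [coord_xs, Finsupp.single_apply]
    | zero => simp
    | add a b _ _ iha ihb => simp [add_smul, Finset.sum_add_distrib, iha, ihb]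
    | smul r a _ iha =>
      simp only [map_smul, Finsupp.smul_apply, smul_assoc, ← Finset.smul_sum, iha]
  | add a b iha ihb => simp [add_smul, Finset.sum_add_distrib, iha, ihb]

theorem coord_empty_of_mem {a : Alg c Z} (ha : a ∈ BarExt.augIdeal (grading c Z)) :
    coord c Z a ∅ = 0 := by
  -- The coordinate at `∅` sees only the component of degree zero, which vanishes on the
  -- augmentation ideal.
  have h : ∀ a, coord c Z a ∅ = coord c Z (DirectSum.decompose (grading c Z) a 0) ∅ := by
    intro a
    induction a using DirectSum.Decomposition.inductionOn (grading c Z) with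
    | zero => simp
    | @homogeneous d a =>
      by_cases hd : d = 0
      · subst hd; simp
      · rw [coord_of_mem c Z a.2 (by simpa using Ne.symm hd),
          DirectSum.decompose_of_mem_ne _ a.2 hd]
        simp
    | add a b iha ihb => simp [iha, ihb]
  have h2 := (HomogeneousIdeal.mem_irrelevant_iff (grading c Z) a).1 ha
  rw [GradedRing.proj_apply] at h2
  rw [h, h2]
  simp

theorem xs_mem_augIdeal {S : Finset (Fin n)} (hS : S.Nonempty) :
    xs c Z S ∈ BarExt.augIdeal (grading c Z) :=
  HomogeneousIdeal.mem_irrelevant_of_mem _ (Finset.card_pos.2 hS) (xs_mem c Z S)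

open Classical in
/-- `x_S` as an element of the augmentation ideal, and zero for `S = ∅`. -/
noncomputable def augXs (S : Finset (Fin n)) : BarExt.augIdeal (grading c Z) :=
  if hS : S.Nonempty then ⟨xs c Z S, xs_mem_augIdeal c Z hS⟩ else 0

theorem coe_augXs {S : Finset (Fin n)} (hS : S.Nonempty) :
    (augXs c Z S : Alg c Z) = xs c Z S := by
  simp [augXs, hS]

theorem augMul_augXs {S T : Finset (Fin n)} (hS : S.Nonempty) (hT : T.Nonempty) :
    BarExt.augMul (grading c Z) (augXs c Z S) (augXs c Z T) =
      lam (mu c Z) S T • augXs c Z (S ∪ T) := by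
  refine Subtype.ext ?_
  change (augXs c Z S : Alg c Z) * (augXs c Z T : Alg c Z) = lam (mu c Z) S T • _
  rw [coe_augXs c Z hS, coe_augXs c Z hT, coe_augXs c Z (hS.mono Finset.subset_union_left),
    xs_mul_xs]

theorem linearIndependent_xs : LinearIndependent 𝕜 (xs c Z) := by
  refine LinearIndependent.of_comp (coord c Z) ?_
  have h : coord c Z ∘ xs c Z = fun S => Finsupp.single S 1 := funext (coord_xs c Z)
  rw [h]
  exact Finsupp.linearIndependent_single_one 𝕜 (Finset (Fin n))

theorem linearIndependent_augXs :
    LinearIndependent 𝕜 fun S : {S : Finset (Fin n) // S.Nonempty} => augXs c Z S.1 := by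
  refine LinearIndependent.of_comp (BarExt.augIdeal (grading c Z)).subtype ?_
  have h : (BarExt.augIdeal (grading c Z)).subtype ∘
      (fun S : {S : Finset (Fin n) // S.Nonempty} => augXs c Z S.1) = xs c Z ∘ Subtype.val :=
    funext fun S => coe_augXs c Z S.2
  rw [h]
  exact (linearIndependent_xs c Z).comp _ Subtype.val_injective

theorem mem_span_augXs (a : BarExt.augIdeal (grading c Z)) :
    a ∈ Submodule.span 𝕜
      (Set.range fun S : {S : Finset (Fin n) // S.Nonempty} => augXs c Z S.1) := by
  have h : a = ∑ S, coord c Z (a : Alg c Z) S • augXs c Z S := by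
    refine Subtype.ext ((sum_coord c Z a).symm.trans ?_)
    rw [Submodule.coe_sum]
    refine Finset.sum_congr rfl fun S _ => ?_
    rcases S.eq_empty_or_nonempty with rfl | hS
    · simp only [coord_empty_of_mem c Z a.2, zero_smul, ZeroMemClass.coe_zero]
    · rw [Submodule.coe_smul, coe_augXs c Z hS]
  rw [h]
  refine Submodule.sum_mem _ fun S _ => ?_
  rcases S.eq_empty_or_nonempty with rfl | hS
  · rw [coord_empty_of_mem c Z a.2, zero_smul]
    exact Submodule.zero_mem _
  · exact Submodule.smul_mem _ _ (Submodule.subset_span ⟨⟨S, hS⟩, rfl⟩)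

/-- The basis `x_S`, `S ≠ ∅`, of the augmentation ideal. -/
noncomputable def augBasis :
    Module.Basis {S : Finset (Fin n) // S.Nonempty} 𝕜 (BarExt.augIdeal (grading c Z)) :=
  Module.Basis.mk (linearIndependent_augXs c Z) fun a _ => mem_span_augXs c Z a

theorem augBasis_apply (S : {S : Finset (Fin n) // S.Nonempty}) :
    augBasis c Z S = augXs c Z S.1 := by
  simp [augBasis]

theorem bijective_algebraMap_zero : Function.Bijective (algebraMap 𝕜 (grading c Z 0)) := by
  constructor
  · intro r s h
    have h2 := congrArg (fun a : grading c Z 0 => coord c Z a ∅) h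
    have h3 : ∀ r : 𝕜, coord c Z (algebraMap 𝕜 (grading c Z 0) r : Alg c Z) ∅ = r := by
      intro r
      change coord c Z (algebraMap 𝕜 (Alg c Z) r) ∅ = r
      rw [Algebra.algebraMap_eq_smul_one, ← xs_empty, map_smul, coord_xs]
      simp
    exact (h3 r).symm.trans (h2.trans (h3 s))
  · rintro ⟨a, ha⟩
    obtain ⟨r, rfl⟩ := Submodule.mem_one.1 (by simpa [grading] using ha)
    exact ⟨r, rfl⟩

end Basis
end SkewAlg

namespace SkewAlg

/-! ### From multilinear cochains to functions on words -/

section Translation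

variable {𝕜 : Type*} [Field 𝕜] {n : ℕ}

theorem bd_ofFn (μ : Fin n → Fin n → 𝕜) {i : ℕ} (F : List (Finset (Fin n)) → 𝕜)
    (t : Fin (i + 1) → Finset (Fin n)) :
    bd μ F (List.ofFn t) = ∑ p : Fin i, (-1) ^ (p : ℕ) * (lam μ (t p.castSucc) (t p.succ) *
      F (List.ofFn (p.castSucc.contractNth (· ∪ ·) t))) := by
  induction i generalizing F with
  | zero => simp [bd]
  | succ i ih =>
    have h0 : List.ofFn ((Fin.castSucc (0 : Fin (i + 1))).contractNth (· ∪ ·) t) =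
        (t 0 ∪ t 1) :: List.ofFn (fun p : Fin i => t p.succ.succ) := by
      rw [List.ofFn_succ]
      rfl
    have hs : ∀ p : Fin i, List.ofFn (p.succ.castSucc.contractNth (· ∪ ·) t) =
        t 0 :: List.ofFn (p.castSucc.contractNth (· ∪ ·) fun q => t q.succ) := by
      intro p
      rw [List.ofFn_succ]
      congr 2
      funext q
      simp [Fin.contractNth]
    have h := ih (fun l => F (t 0 :: l)) (fun q => t q.succ)
    rw [List.ofFn_succ] at h
    rw [List.ofFn_succ, List.ofFn_succ, bd, h, Fin.sum_univ_succ, h0, sub_eq_add_neg,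
      ← Finset.sum_neg_distrib]
    congr 1
    · simp
    · refine Finset.sum_congr rfl fun p _ => ?_
      rw [hs, Fin.val_succ, pow_succ, Fin.succ_castSucc]
      ring

variable (c : Fin n → Fin n → 𝕜ˣ) (Z : Fin n → Fin n → Prop)

theorem contractNth_nonempty {i : ℕ} (p : Fin i) {t : Fin (i + 1) → Finset (Fin n)}
    (ht : ∀ q, (t q).Nonempty) (q : Fin i) :
    (p.castSucc.contractNth (· ∪ ·) t q).Nonempty := by
  rw [Fin.contractNth]
  split_ifs
  · exact ht _
  · exact (ht _).mono Finset.subset_union_left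
  · exact ht _

theorem apply_merge {i : ℕ} (f : BarExt.Cochain (grading c Z) i) (p : Fin i)
    {t : Fin (i + 1) → Finset (Fin n)} (ht : ∀ q, (t q).Nonempty) :
    f (BarExt.merge (grading c Z) p fun q => augXs c Z (t q)) =
      lam (mu c Z) (t p.castSucc) (t p.succ) *
        f fun q => augXs c Z (p.castSucc.contractNth (· ∪ ·) t q) := by
  have h : BarExt.merge (grading c Z) p (fun q => augXs c Z (t q)) =
      Function.update (fun q => augXs c Z (p.castSucc.contractNth (· ∪ ·) t q)) p
        (lam (mu c Z) (t p.castSucc) (t p.succ) •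
          augXs c Z (p.castSucc.contractNth (· ∪ ·) t p)) := by
    funext k
    rcases lt_trichotomy k p with h | rfl | h
    · rw [Function.update_of_ne h.ne, BarExt.merge_of_lt _ _ _ _ h,
        Fin.contractNth_apply_of_lt _ _ _ _ h]
    · rw [Function.update_self, BarExt.merge_self, augMul_augXs c Z (ht _) (ht _),
        Fin.contractNth_apply_of_eq _ _ _ _ rfl]
    · rw [Function.update_of_ne h.ne', BarExt.merge_of_gt _ _ _ _ h,
        Fin.contractNth_apply_of_gt _ _ _ _ h]
  rw [h, f.map_update_smul, Function.update_eq_self, smul_eq_mul]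

/-- The signs are `(-1)^(p+1)` in `BarExt.diff` and `(-1)^p` in `bd`, so the two differentials are
opposite. -/
theorem diff_augXs {i : ℕ} (f : BarExt.Cochain (grading c Z) i) (F : List (Finset (Fin n)) → 𝕜)
    (hF : ∀ s : Fin i → Finset (Fin n), (∀ p, (s p).Nonempty) →
      F (List.ofFn s) = f fun p => augXs c Z (s p))
    {t : Fin (i + 1) → Finset (Fin n)} (ht : ∀ p, (t p).Nonempty) :
    BarExt.diff (grading c Z) i f (fun p => augXs c Z (t p)) = -bd (mu c Z) F (List.ofFn t) := by
  rw [BarExt.diff_apply, bd_ofFn, ← Finset.sum_neg_distrib]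
  refine Finset.sum_congr rfl fun p _ => ?_
  rw [apply_merge c Z f p ht, hF _ (contractNth_nonempty p ht)]
  ring

theorem augBasis_coord (S : {S : Finset (Fin n) // S.Nonempty})
    (a : BarExt.augIdeal (grading c Z)) :
    (augBasis c Z).coord S a = coord c Z (a : Alg c Z) S.1 := by
  have h : (augBasis c Z).coord S =
      (Finsupp.lapply S.1 ∘ₗ coord c Z) ∘ₗ (BarExt.augIdeal (grading c Z)).subtype := by
    refine (augBasis c Z).ext fun T => ?_
    simp only [LinearMap.comp_apply, Submodule.subtype_apply, augBasis_apply, coe_augXs c Z T.2,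
      coord_xs, Finsupp.lapply_apply]
    rw [← augBasis_apply, Module.Basis.coord_apply, Module.Basis.repr_self,
      Finsupp.single_apply, Finsupp.single_apply]
    simp only [Subtype.ext_iff]
  rw [h]
  rfl

/-- The cochain with given values on words in the basis. -/
noncomputable def ofWords (i : ℕ) (G : List (Finset (Fin n)) → 𝕜) :
    BarExt.Cochain (grading c Z) i :=
  ∑ t : Fin i → {S : Finset (Fin n) // S.Nonempty}, G (List.ofFn fun p => (t p).1) •
    (MultilinearMap.mkPiAlgebra 𝕜 (Fin i) 𝕜).compLinearMap fun p => (augBasis c Z).coord (t p)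

theorem ofWords_apply (i : ℕ) (G : List (Finset (Fin n)) → 𝕜)
    (a : Fin i → BarExt.augIdeal (grading c Z)) :
    ofWords c Z i G a = ∑ t : Fin i → {S : Finset (Fin n) // S.Nonempty},
      G (List.ofFn fun p => (t p).1) * ∏ p, coord c Z (a p : Alg c Z) (t p).1 := by
  simp [ofWords, augBasis_coord, -Module.Basis.coord_apply]

theorem ofWords_augXs (i : ℕ) (G : List (Finset (Fin n)) → 𝕜) {s : Fin i → Finset (Fin n)}
    (hs : ∀ p, (s p).Nonempty) :
    ofWords c Z i G (fun p => augXs c Z (s p)) = G (List.ofFn s) := by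
  rw [ofWords_apply, Finset.sum_eq_single fun p => ⟨s p, hs p⟩]
  · simp [coe_augXs c Z (hs _), coord_xs]
  · intro t _ hne
    obtain ⟨p, hp⟩ := Function.ne_iff.1 hne
    rw [Finset.prod_eq_zero (Finset.mem_univ p), mul_zero]
    rw [coe_augXs c Z (hs p), coord_xs, Finsupp.single_eq_of_ne]
    exact fun h => hp (Subtype.ext h)
  · simp

theorem ofWords_mem_cochainDeg {i j : ℕ} {G : List (Finset (Fin n)) → 𝕜} (hG : HasDeg i j G) :
    ofWords c Z i G ∈ BarExt.cochainDeg (grading c Z) i j := by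
  intro e a ha he
  rw [ofWords_apply]
  refine Finset.sum_eq_zero fun t _ => ?_
  by_cases h : ∀ p, (t p).1.card = e p
  · rw [hG _ (by simp), zero_mul]
    rw [List.map_ofFn, List.sum_ofFn]
    simpa [h] using he
  · push Not at h
    obtain ⟨p, hp⟩ := h
    rw [Finset.prod_eq_zero (Finset.mem_univ p) (coord_of_mem c Z (ha p) hp), mul_zero]

/-- The values of a cochain on words in the basis. -/
noncomputable def toWords {i : ℕ} (f : BarExt.Cochain (grading c Z) i)
    (l : List (Finset (Fin n))) : 𝕜 :=
  f fun p => augXs c Z (l.getD p ∅)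

theorem toWords_ofFn {i : ℕ} (f : BarExt.Cochain (grading c Z) i) (s : Fin i → Finset (Fin n)) :
    toWords c Z f (List.ofFn s) = f fun p => augXs c Z (s p) := by
  simp [toWords]

theorem exists_eq_ofFn {α : Type*} {i : ℕ} {l : List α} (h : l.length = i) :
    ∃ s : Fin i → α, l = List.ofFn s := by
  subst h
  exact ⟨l.get, (List.ofFn_get l).symm⟩

theorem hasDeg_toWords {i j : ℕ} {f : BarExt.Cochain (grading c Z) i}
    (hf : f ∈ BarExt.cochainDeg (grading c Z) i j) : HasDeg i j (toWords c Z f) := by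
  intro l hl hd
  obtain ⟨s, rfl⟩ := exists_eq_ofFn hl
  rw [toWords_ofFn]
  by_cases hs : ∀ p, (s p).Nonempty
  · refine hf (fun p => (s p).card) _ (fun p => ?_) ?_
    · rw [coe_augXs c Z (hs p)]
      exact xs_mem c Z (s p)
    · rwa [List.map_ofFn, List.sum_ofFn] at hd
  · push Not at hs
    obtain ⟨p, hp⟩ := hs
    -- An empty letter becomes the zero vector under `augXs`.
    exact f.map_coord_zero p (by simp [hp, augXs])

/-- Multilinear forms are determined by their values on the basis, so a primitive on words, extended
multilinearly by `ofWords`, is a primitive of the cochain up to sign. -/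
theorem cocycles_le_coboundaries {i j : ℕ} (hij : i ≠ j) :
    BarExt.cocycles (grading c Z) i j ≤ BarExt.coboundaries (grading c Z) i j := by
  rintro f ⟨hf, hdeg⟩
  obtain ⟨G, hG, hbd⟩ := exists_bd_eq (mu_self c Z) (mu_of_lt c Z) hij.symm (toWords c Z f)
    (hasDeg_toWords c Z hdeg) fun l hl => by
      obtain ⟨t, rfl⟩ := exists_eq_ofFn hl.1
      have ht : ∀ p, (t p).Nonempty := List.forall_mem_ofFn_iff.1 hl.2
      rw [← neg_eq_zero, ← diff_augXs c Z f _ (fun s _ => toWords_ofFn c Z f s) ht,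
        LinearMap.mem_ker.1 hf]
      rfl
  have hval : ∀ s : Fin i → {S : Finset (Fin n) // S.Nonempty},
      f (fun p => augBasis c Z (s p)) = bd (mu c Z) G (List.ofFn fun p => (s p).1) := by
    intro s
    rw [hbd _ ⟨by simp, List.forall_mem_ofFn_iff.2 fun p => (s p).2⟩, toWords_ofFn]
    simp only [augBasis_apply]
  cases i with
  | zero =>
    -- There are no coboundaries in homological degree zero, and `bd` vanishes on the empty word, so
    -- `f` itself is zero.
    refine (Submodule.mem_bot 𝕜).2 (Module.Basis.ext_multilinear (fun _ => augBasis c Z) ?_)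
    intro v
    rw [hval, List.ofFn_zero]
    rfl
  | succ i =>
    refine ⟨-ofWords c Z i G, Submodule.neg_mem _ (ofWords_mem_cochainDeg c Z (hG i rfl)), ?_⟩
    refine Module.Basis.ext_multilinear (fun _ => augBasis c Z) fun v => ?_
    rw [hval, map_neg, neg_apply]
    simp only [augBasis_apply]
    rw [diff_augXs c Z _ G (fun s hs => (ofWords_augXs c Z i G hs).symm) fun p => (v p).2, neg_neg]

end Translation
end SkewAlg

/-- The transitivity hypothesis `hZ` is not needed: the words `x_S` form a PBW basis for every choice
of the relations. -/
theorem mainTheorem9 {𝕜 : Type*} [Field 𝕜] (n : ℕ) (c : Fin n → Fin n → 𝕜ˣ)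
    (Z : Fin n → Fin n → Prop)
    (hZ : ∀ i j k : Fin n, i < j → j < k → Z k j → Z j i → Z k i) :
    BarExt.IsKoszul (SkewAlg.grading c Z) :=
  ⟨SkewAlg.bijective_algebraMap_zero c Z, fun _ _ hij =>
    LinearMap.le_ker_iff_map.1 <| (SkewAlg.cocycles_le_coboundaries c Z hij).trans_eq
      (Submodule.ker_mkQ _).symm⟩
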